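/- Let $n,d\in\mathbb{N}$, $Y=(0,1)^d$, $\Theta=[-\pi,\pi)^d$, and equip $\mathbb{C}^{n\times d}$ with the Frobenius inner product. For $\theta\in\Theta$ let $H^1_\theta(Y)$ be the closure in the $H^1(Y)$ norm of the smooth functions $\phi$ on $\mathbb{R}^d$ with $\phi(\cdot+k)=e^{\mathrm{i}\theta\cdot k}\phi$ $(k\in\mathbb{Z}^d)$. Let $\mathrm{grad}_\theta\colon [H^1_\theta(Y)]^n\subseteq[L^2(Y)]^n\to[L^2(Y)]^{n\times d}$, $(\phi_i)_i\mapsto(\partial_j\phi_i)_{i,j}$, and $\mathrm{div}_\#:=-(\mathrm{grad}_0)^*$. Let $a\in L^\infty(\mathbb{R}^d;L(\mathbb{C}^{n\times d}))$ be $\mathbb{Z}^d$-periodic, coercive ($\mathrm{Re}\,a\ge\nu$ a.e. for some $\nu>0$) and self-adjoint, with $aX\in\ker(\mathrm{div}_\#)$ for all $X\in\mathbb{C}^{n\times d}$. Then for all $\theta\in\Theta$, $r\in\{1,\dots,n\}$, $s\in\{1,\dots,d\}$ there is a unique $N^{(rs)}_\theta\in[H^1_\theta(Y)]^n$ with components orthogonal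 in $L^2(Y)$ to $e^{\mathrm{i}\theta\cdot y}$ such that $$\big\langle a[\mathrm{grad}_\theta N^{(rs)}_\theta+e^{\mathrm{i}\theta\cdot y}\,e_r\otimes e_s],\,\mathrm{grad}_\theta\phi\big\rangle_{L^2(Y)}=0$$ for all $\phi\in[H^1_\theta(Y)]^n$ with components orthogonal to $e^{\mathrm{i}\theta\cdot y}$. With $a_{ijkl}$ the components of $a$, $(aX)_{ij}=\sum_{k,l}a_{ijkl}X_{kl}$, define $$a^{\mathrm{hom}}_{ijrs}(\theta):=\sum_{k=1}^n\sum_{l=1}^d\int_Y a_{ijkl}\big(\partial_l N^{(rs)}_{\theta k}+e^{\mathrm{i}\theta\cdot y}\delta_{kr}\delta_{ls}\big)e^{-\mathrm{i}\theta\cdot y}\,dy .$$ Then $$a^{\mathrm{hom}}(\theta)=a^{\mathrm{hom}}(0)\ \text{ for all }\theta\in\Theta\setminus\{0\}\quad\Longleftrightarrow\quad a\text{ is constant (almost everywhere)}.$$ Moreover, the fibre-homogenised tensor differs from the classical one in general: if $n\ge1$ and $d\ge2$, there are an $a$ as above and a $\theta\in\Theta\setminus\{0\}$ with $a^{\mathrm{hom}}(\theta)\neq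 a^{\mathrm{hom}}(0)$. -/

import Mathlib

open MeasureTheory Complex
open scoped ContDiff

namespace FibreHom

/-- `ℝ^d` with the Euclidean norm and Lebesgue measure. -/
abbrev Pt (d : ℕ) := EuclideanSpace ℝ (Fin d)

/-- `ℂ^n`. -/
abbrev Vec (n : ℕ) := EuclideanSpace ℂ (Fin n)

/-- `ℂ^{n × d}` with the Frobenius inner product. -/
abbrev Mat (n d : ℕ) := EuclideanSpace ℂ (Fin n × Fin d)

/-- `L(ℂ^{n × d})`. -/
abbrev Tensor (n d : ℕ) := Mat n d →L[ℂ] Mat n d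

/-- The periodicity cell `Y = (0,1)^d`. -/
def cell (d : ℕ) : Set (Pt d) := {y | ∀ j, y j ∈ Set.Ioo (0 : ℝ) 1}

/-- Lebesgue measure on `Y`. -/
noncomputable abbrev cellMeasure (d : ℕ) : Measure (Pt d) := volume.restrict (cell d)

/-- `Θ = [-π, π)^d`. -/
def quasimomenta (d : ℕ) : Set (Pt d) := {θ | ∀ j, θ j ∈ Set.Ico (-Real.pi) Real.pi}

/-- The point of `ℝ^d` with integer coordinates `k`. -/
noncomputable def latticePt {d : ℕ} (k : Fin d → ℤ) : Pt d := WithLp.toLp 2 fun j => (k j : ℝ)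

/-- The plane wave `y ↦ exp(i θ · y)`. -/
noncomputable def wave {d : ℕ} (θ y : Pt d) : ℂ := cexp (I * ((∑ j, θ j * y j : ℝ) : ℂ))

/-- The matrix unit `e_r ⊗ e_s`. -/
noncomputable def matUnit {n d : ℕ} (r : Fin n) (s : Fin d) : Mat n d :=
  EuclideanSpace.single (r, s) 1

/-- The class of coefficients `a ∈ L^∞(ℝ^d; L(ℂ^{n × d}))` that are `ℤ^d`-periodic and coercive,
`Re a ≥ ν`, for some `ν > 0`.  All conditions are on the `L^∞`-class of `a`, hence hold a.e. -/
structure PeriodicCoercive {n d : ℕ} (a : Pt d → Tensor n d) : Prop where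
  memLp : MemLp a ⊤ (volume : Measure (Pt d))
  periodic : ∀ k : Fin d → ℤ, ∀ᵐ x : Pt d, a (x + latticePt k) = a x
  coercive : ∃ ν : ℝ, 0 < ν ∧ ∀ᵐ x : Pt d, ∀ X : Mat n d, ν * ‖X‖ ^ 2 ≤ (inner ℂ X (a x X)).re

/-- `[L²(Y)]^n`. -/
noncomputable abbrev L2Vec (n d : ℕ) := Lp (Vec n) 2 (cellMeasure d)

/-- `[L²(Y)]^{n × d}`. -/
noncomputable abbrev L2Mat (n d : ℕ) := Lp (Mat n d) 2 (cellMeasure d)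

/-- `[C^∞_θ(Y)]^n`: smooth `φ : ℝ^d → ℂ^n` with `φ(x + k) = exp(i θ · k) φ(x)` for `k ∈ ℤ^d`. -/
structure SmoothQuasiPeriodic {n d : ℕ} (θ : Pt d) (φ : Pt d → Vec n) : Prop where
  smooth : ContDiff ℝ ∞ φ
  quasiPeriodic : ∀ (k : Fin d → ℤ) (x : Pt d),
    φ (x + latticePt k) = wave θ (latticePt k) • φ x

/-- The classical gradient `(∂_j φ_i)_{i,j}` of `φ : ℝ^d → ℂ^n`. -/
noncomputable def gradient {n d : ℕ} (φ : Pt d → Vec n) (y : Pt d) : Mat n d :=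
  WithLp.toLp 2 fun p => fderiv ℝ φ y (EuclideanSpace.single p.2 1) p.1

/-- The graph of the operator `grad_θ : [H¹_θ(Y)]^n ⊆ [L²(Y)]^n → [L²(Y)]^{n × d}`.
The space `H¹_θ(Y)` is the closure of `C^∞_θ(Y)` in the norm of `H¹(Y)`.  Hence `u ∈ [H¹_θ(Y)]^n`
and `G = grad_θ u` if and only if `(u, G)` is a limit in `L² × L²` of pairs `(φ, grad φ)` with
`φ ∈ [C^∞_θ(Y)]^n`. -/
def gradGraph {n d : ℕ} (θ : Pt d) : Set (L2Vec n d × L2Mat n d) :=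
  closure {p | ∃ φ : Pt d → Vec n, SmoothQuasiPeriodic θ φ ∧
    (p.1 : Pt d → Vec n) =ᵐ[cellMeasure d] φ ∧
    (p.2 : Pt d → Mat n d) =ᵐ[cellMeasure d] gradient φ}

/-- `q ∈ dom(div_θ)` and `div_θ q = f`, where `div_θ = -(grad_θ)^*` is the negative of the
Hilbert space adjoint of `grad_θ`. -/
def HasDiv {n d : ℕ} (θ : Pt d) (q : L2Mat n d) (f : L2Vec n d) : Prop :=
  ∀ p ∈ gradGraph (n := n) θ, inner ℂ p.2 q = -inner ℂ p.1 f

/-- `ker(div_θ)`.  The periodic case, `div_#`, is `θ = 0`. -/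
def kerDiv {n d : ℕ} (θ : Pt d) : Set (L2Mat n d) := {q | HasDiv θ q 0}

/-- `u ⊥ exp(i θ · y)` in `L²(Y)`, for every component of `u`. -/
def OrthWave {n d : ℕ} (θ : Pt d) (u : L2Vec n d) : Prop :=
  ∀ i, ∫ y in cell d, starRingEnd ℂ (wave θ y) * u y i = 0

/-- The cell problem with data `(r, s)`: `p = (N, grad_θ N)` with
`N ∈ [H¹_θ(Y) ⊥ exp(i θ · y)]^n` and
`⟨a [grad_θ N + exp(i θ · y) e_r ⊗ e_s], grad_θ φ⟩ = 0` for all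
`φ ∈ [H¹_θ(Y) ⊥ exp(i θ · y)]^n`. -/
structure IsCellSolution {n d : ℕ} (a : Pt d → Tensor n d) (θ : Pt d) (r : Fin n) (s : Fin d)
    (p : L2Vec n d × L2Mat n d) : Prop where
  mem_gradGraph : p ∈ gradGraph θ
  orthWave : OrthWave θ p.1
  eq_zero : ∀ t ∈ gradGraph (n := n) θ, OrthWave θ t.1 →
    ∫ y in cell d, inner ℂ (t.2 y) (a y (p.2 y + wave θ y • matUnit r s)) = 0

/-- The solution `(N^{(rs)}_θ, grad_θ N^{(rs)}_θ)` of the cell problem. -/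
noncomputable def cellSolution {n d : ℕ} (a : Pt d → Tensor n d) (θ : Pt d) (r : Fin n)
    (s : Fin d) : L2Vec n d × L2Mat n d :=
  Classical.epsilon (IsCellSolution a θ r s)

/-- The components `A_{ijkl}` of `A ∈ L(ℂ^{n × d})`, with `(A X)_{ij} = ∑_{k,l} A_{ijkl} X_{kl}`.
For self-adjoint `A` this is the same as `inner ℂ (A (matUnit i j)) (matUnit k l)`. -/
noncomputable def component {n d : ℕ} (A : Tensor n d) (i : Fin n) (j : Fin d) (k : Fin n)
    (l : Fin d) : ℂ :=
  inner ℂ (matUnit i j) (A (matUnit k l))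

/-- The fibre-homogenised tensor, given by its components
`a^hom_{ijrs}(θ) = ∑_{k,l} ∫_Y a_{ijkl} (∂_l N^{(rs)}_{θ k} + exp(iθ·y) δ_{kr} δ_{ls}) exp(-iθ·y) dy`.
-/
noncomputable def aHom {n d : ℕ} (a : Pt d → Tensor n d) (θ : Pt d) (i : Fin n) (j : Fin d)
    (r : Fin n) (s : Fin d) : ℂ :=
  ∑ k : Fin n, ∑ l : Fin d, ∫ y in cell d,
    component (a y) i j k l *
      ((cellSolution a θ r s).2 y (k, l) +
        wave θ y * ((if k = r then 1 else 0) * (if l = s then 1 else 0))) * wave (-θ) y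

/-- The standing assumptions: `a` is periodic and coercive, self-adjoint, and
`a X ∈ ker(div_#)` for all `X ∈ ℂ^{n × d}`. -/
structure SelfAdjointDivFree {n d : ℕ} (a : Pt d → Tensor n d) : Prop where
  periodicCoercive : PeriodicCoercive a
  selfAdjoint : ∀ᵐ x : Pt d, IsSelfAdjoint (a x)
  divFree : ∀ X : Mat n d, ∃ q ∈ kerDiv (n := n) (d := d) 0,
    (q : Pt d → Mat n d) =ᵐ[cellMeasure d] fun y => a y X

/-- `a` is constant, as an element of `L^∞`. -/
def IsConstant {n d : ℕ} (a : Pt d → Tensor n d) : Prop :=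
  ∃ A : Tensor n d, ∀ᵐ x : Pt d, a x = A

end FibreHom

/-! Everything is read off Fourier coefficients at the frequencies `θ + 2πk`. On them `grad_θ`
multiplies by `i(θ + 2πk)`, and for `k ≠ 0` this vector has length at least `π` because `θ` lies in
`Θ`. Parseval then gives a Poincaré inequality (`pi_mul_norm_le`), so the admissible gradients form
a closed subspace, and Lax–Milgram solves the cell problem there.

Divergence-freeness says that the corrector vanishes at `θ = 0`, so `a^hom(0)` is the mean of `a`.
Write `E` for the wave with amplitude `e_r ⊗ e_s` and `G` for the gradient of its corrector. Since
conjugation by the wave does not change the mean, `a^hom_{rsrs}(θ)` equals the mean of `a_{rsrs}`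
plus `⟨E, aG⟩`. If it agrees with `a^hom_{rsrs}(0)`, then `⟨E, aG⟩ = 0`; testing the cell problem
with its own solution and using self-adjointness gives `⟨G, aG⟩ = 0`, and coercivity gives `G = 0`.

Once all correctors vanish, plane waves with `k ≠ 0` as test functions show that the `k`-th Fourier
coefficient of `aX` is orthogonal to `v ⊗ (θ + 2πk)` for every `θ`. Subtracting `θ = 0` from `θ =
e_j` isolates column `j`, so every nonzero Fourier coefficient vanishes and `a` is constant
(`exists_ae_cell_eq`). Conversely, a constant `a` has zero correctors, so `a^hom(θ)` is again the
mean. The last claim follows by applying the equivalence to a nonconstant divergence-free laminate.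
-/

namespace FibreHom

/-! ### Plane waves -/

section Wave

variable {d : ℕ}

lemma wave_add_left (θ ξ y : Pt d) : wave (θ + ξ) y = wave θ y * wave ξ y := by
  simp only [wave, ← Complex.exp_add]
  congr 1
  push_cast [PiLp.add_apply, add_mul, Finset.sum_add_distrib]
  ring

lemma wave_add_right (θ y z : Pt d) : wave θ (y + z) = wave θ y * wave θ z := by
  simp only [wave, ← Complex.exp_add]
  congr 1
  push_cast [PiLp.add_apply, mul_add, Finset.sum_add_distrib]
  ring

@[simp] lemma wave_zero_left (y : Pt d) : wave 0 y = 1 := by simp [wave]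

@[simp] lemma norm_wave (θ y : Pt d) : ‖wave θ y‖ = 1 := by
  rw [wave, mul_comm, Complex.norm_exp_ofReal_mul_I]

lemma conj_wave (θ y : Pt d) : starRingEnd ℂ (wave θ y) = wave (-θ) y := by
  simp only [wave, ← Complex.exp_conj, map_mul, Complex.conj_I, Complex.conj_ofReal]
  congr 1
  simp

lemma wave_mul_wave_neg (θ y : Pt d) : wave θ y * wave (-θ) y = 1 := by
  rw [← wave_add_left, add_neg_cancel, wave_zero_left]

lemma contDiff_wave (θ : Pt d) : ContDiff ℝ ∞ (wave θ) := by
  unfold wave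
  have h : ContDiff ℝ ∞ fun y : Pt d => ∑ j, θ j * y j := by fun_prop
  exact (contDiff_const.mul (Complex.ofRealCLM.contDiff.comp h)).cexp

lemma continuous_wave (θ : Pt d) : Continuous (wave θ) := (contDiff_wave θ).continuous

lemma hasFDerivAt_wave (θ y : Pt d) :
    HasFDerivAt (wave θ) (wave θ y •
      (I • (Complex.ofRealCLM.comp (∑ j, θ j • (EuclideanSpace.proj j : Pt d →L[ℝ] ℝ))))) y := by
  have h : HasFDerivAt (fun y : Pt d => ((∑ j, θ j * y j : ℝ) : ℂ))
      (Complex.ofRealCLM.comp (∑ j, θ j • (EuclideanSpace.proj j : Pt d →L[ℝ] ℝ))) y := by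
    have := (Complex.ofRealCLM.comp
      (∑ j, θ j • (EuclideanSpace.proj j : Pt d →L[ℝ] ℝ))).hasFDerivAt (x := y)
    convert this using 1
    ext z
    simp
  exact (h.const_mul I).cexp

lemma fderiv_wave_single (θ y : Pt d) (j : Fin d) :
    fderiv ℝ (wave θ) y (EuclideanSpace.single j 1) = I * θ j * wave θ y := by
  rw [(hasFDerivAt_wave θ y).fderiv]
  simp
  ring

/-- The quasimomentum `θ + 2πk`. -/
noncomputable def shift (θ : Pt d) (k : Fin d → ℤ) : Pt d := θ + (2 * Real.pi) • latticePt k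

lemma shift_apply (θ : Pt d) (k : Fin d → ℤ) (j : Fin d) :
    shift θ k j = θ j + 2 * Real.pi * k j := by
  simp [shift, latticePt]

@[simp] lemma shift_zero (θ : Pt d) : shift θ 0 = θ := by
  ext j; simp [shift_apply]

lemma wave_shift (θ : Pt d) (k : Fin d → ℤ) (y : Pt d) :
    wave (shift θ k) y = wave θ y * wave (shift 0 k) y := by
  rw [← wave_add_left]; simp [shift]

lemma wave_shift_zero_latticePt (k m : Fin d → ℤ) : wave (shift 0 k) (latticePt m) = 1 := by
  rw [wave, Complex.exp_eq_one_iff]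
  refine ⟨∑ j, k j * m j, ?_⟩
  simp only [shift_apply, latticePt]
  push_cast
  rw [Finset.mul_sum, Finset.sum_mul]
  refine Finset.sum_congr rfl fun j _ => ?_
  simp; ring

lemma wave_shift_latticePt (θ : Pt d) (k m : Fin d → ℤ) :
    wave (shift θ k) (latticePt m) = wave θ (latticePt m) := by
  rw [wave_shift, wave_shift_zero_latticePt, mul_one]

end Wave

/-! ### The periodicity cell -/

section Cell

variable {d : ℕ}

lemma measurableSet_cell : MeasurableSet (cell d) := by
  unfold cell
  rw [Set.ofPred_forall]
  exact MeasurableSet.iInter fun j => (measurableSet_Ioo.preimage (by fun_prop))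

lemma cell_eq_preimage :
    cell d = (WithLp.ofLp : Pt d → Fin d → ℝ) ⁻¹' (Set.univ.pi fun _ => Set.Ioo 0 1) := by
  ext y; simp [cell]

lemma measurePreserving_ofLp_cell :
    MeasurePreserving (WithLp.ofLp : Pt d → Fin d → ℝ) (cellMeasure d)
      (volume.restrict (Set.univ.pi fun _ => Set.Ioo (0 : ℝ) 1)) := by
  rw [cellMeasure, cell_eq_preimage]
  exact (PiLp.volume_preserving_ofLp (Fin d)).restrict_preimage
    (MeasurableSet.univ_pi fun _ => measurableSet_Ioo)

lemma volume_cell : volume (cell d) = 1 := by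
  rw [cell_eq_preimage, (PiLp.volume_preserving_ofLp (Fin d)).measure_preimage
    (MeasurableSet.univ_pi fun _ => measurableSet_Ioo).nullMeasurableSet, volume_pi,
    Measure.pi_pi]
  simp

instance : IsProbabilityMeasure (cellMeasure d) := ⟨by simp [volume_cell]⟩

/-- The faces of the cube are null. The closed box in `Fin d → ℝ` is the domain on which the
divergence theorem is available. -/
lemma setIntegral_cell {E : Type*} [NormedAddCommGroup E] [NormedSpace ℝ E] (f : Pt d → E) :
    ∫ y in cell d, f y = ∫ x in Set.Icc (0 : Fin d → ℝ) 1, f (WithLp.toLp 2 x) := by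
  rw [← setIntegral_congr_set (μ := volume) (f := fun x => f (WithLp.toLp 2 x))
    (Measure.univ_pi_Ioo_ae_eq_Icc (μ := fun _ : Fin d => (volume : Measure ℝ)) (f := 0) (g := 1))]
  exact (measurePreserving_ofLp_cell (d := d)).integral_comp
    (MeasurableEquiv.toLp 2 (Fin d → ℝ)).symm.measurableEmbedding
    (fun x => f (WithLp.toLp 2 x))

lemma exists_bound_on_cell {E : Type*} [NormedAddCommGroup E] {f : Pt d → E}
    (hf : Continuous f) : ∃ C, ∀ y ∈ cell d, ‖f y‖ ≤ C := by
  have hc : IsCompact ((WithLp.toLp 2 : (Fin d → ℝ) → Pt d) '' Set.Icc 0 1) :=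
    isCompact_Icc.image (PiLp.continuous_toLp 2 _)
  obtain ⟨C, hC⟩ := hc.exists_bound_of_continuousOn hf.continuousOn
  exact ⟨C, fun y hy => hC y ⟨WithLp.ofLp y, ⟨fun j => (hy j).1.le, fun j => (hy j).2.le⟩, rfl⟩⟩

lemma memLp_cell_of_continuous {E : Type*} [NormedAddCommGroup E]
    {f : Pt d → E} (hf : Continuous f) [SecondCountableTopologyEither (Pt d) E] (p : ENNReal) :
    MemLp f p (cellMeasure d) := by
  obtain ⟨C, hC⟩ := exists_bound_on_cell hf
  exact MemLp.of_bound hf.aestronglyMeasurable C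
    ((ae_restrict_iff' measurableSet_cell).2 (.of_forall hC))

end Cell

/-! ### Parseval's identity on the cell -/

section Parseval

variable {d : ℕ}

noncomputable local instance instMeasureSpaceUnitAddCircleHaar : MeasureSpace UnitAddCircle :=
  ⟨AddCircle.haarAddCircle⟩

/-- The section of the quotient map from `ℝ^d` to the torus with values in `(0,1]^d`. -/
noncomputable def torusSection (x : UnitAddTorus (Fin d)) : Pt d :=
  WithLp.toLp 2 (UnitAddTorus.measurableEquivPiIoc (0 : Fin d → ℝ) x).1

/-- The section takes values in a half-open cube, which differs from the open cell by a null set.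
This transports the Fourier theory of the torus to the cell. -/
lemma measurePreserving_torusSection :
    MeasurePreserving (torusSection (d := d)) volume (cellMeasure d) := by
  have h1 := UnitAddTorus.measurePreserving_equivPiIoc (0 : Fin d → ℝ)
  have hset : {x : Fin d → ℝ | ∀ i, x i ∈ Set.Ioc ((0 : Fin d → ℝ) i) ((0 : Fin d → ℝ) i + 1)} =
      Set.univ.pi fun i => Set.Ioc ((0 : Fin d → ℝ) i) ((1 : Fin d → ℝ) i) := by
    ext x; simp
  have hm : MeasurableSet
      {x : Fin d → ℝ | ∀ i, x i ∈ Set.Ioc ((0 : Fin d → ℝ) i) ((0 : Fin d → ℝ) i + 1)} := by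
    rw [hset]; exact MeasurableSet.univ_pi fun _ => measurableSet_Ioc
  have h2 : MeasurePreserving
      (fun x : {x : Fin d → ℝ // ∀ i, x i ∈ Set.Ioc ((0 : Fin d → ℝ) i) ((0 : Fin d → ℝ) i + 1)} =>
        x.1) (Measure.comap Subtype.val volume)
      (volume.restrict (Set.univ.pi fun _ => Set.Ioo (0 : ℝ) 1)) := by
    refine ⟨measurable_subtype_coe, ?_⟩
    have := map_comap_subtype_coe hm (volume : Measure (Fin d → ℝ))
    refine this.trans ?_
    rw [hset]
    refine Measure.restrict_congr_set ?_
    exact Measure.univ_pi_Ioc_ae_eq_Icc.trans Measure.univ_pi_Ioo_ae_eq_Icc.symm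
  have h3 : MeasurePreserving (WithLp.toLp 2 : (Fin d → ℝ) → Pt d)
      (volume.restrict (Set.univ.pi fun _ => Set.Ioo (0 : ℝ) 1)) (cellMeasure d) :=
    (measurePreserving_ofLp_cell (d := d)).symm (MeasurableEquiv.toLp 2 (Fin d → ℝ)).symm
  exact (h3.comp h2).comp h1

lemma mFourier_eq_wave (k : Fin d → ℤ) (x : UnitAddTorus (Fin d)) :
    UnitAddTorus.mFourier k x = wave (shift 0 k) (torusSection x) := by
  have hx : x = fun i => ((torusSection x i : ℝ) : UnitAddCircle) :=
    ((UnitAddTorus.measurableEquivPiIoc (0 : Fin d → ℝ)).symm_apply_apply x).symm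
  conv_lhs => rw [hx]
  simp only [UnitAddTorus.mFourier, ContinuousMap.coe_mk, fourier_coe_apply, wave,
    ← Complex.exp_sum]
  congr 1
  push_cast
  rw [Finset.mul_sum]
  refine Finset.sum_congr rfl fun j _ => ?_
  rw [shift_apply]
  push_cast [PiLp.zero_apply]
  ring

/-- The coefficient `∫_Y exp(-i ξ · y) f(y) dy`. -/
noncomputable def waveCoeff (ξ : Pt d) (f : Pt d → ℂ) : ℂ :=
  ∫ y in cell d, starRingEnd ℂ (wave ξ y) * f y

lemma hasSum_sq_waveCoeff_zero {f : Pt d → ℂ} (hf : MemLp f 2 (cellMeasure d)) :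
    HasSum (fun k => ‖waveCoeff (shift 0 k) f‖ ^ 2) (∫ y in cell d, ‖f y‖ ^ 2) := by
  have hΦ := measurePreserving_torusSection (d := d)
  have hF := hf.comp_measurePreserving hΦ
  have h := UnitAddTorus.hasSum_sq_mFourierCoeff hF.toLp
  have key : ∀ {E : Type} [NormedAddCommGroup E] [NormedSpace ℝ E] (g : Pt d → E),
      AEStronglyMeasurable g (cellMeasure d) →
      ∫ x, g (torusSection x) = ∫ y in cell d, g y := by
    intro E _ _ g hg
    rw [← hΦ.map_eq] at hg
    rw [← integral_map hΦ.aemeasurable hg, hΦ.map_eq]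
  convert h using 1
  · funext k
    congr 2
    unfold waveCoeff
    refine (key _ (((Complex.continuous_conj.comp
      (continuous_wave _)).aestronglyMeasurable).mul hf.1)).symm.trans (integral_congr_ae ?_)
    filter_upwards [hF.coeFn_toLp] with x hx
    rw [hx, UnitAddTorus.mFourier_neg, mFourier_eq_wave]
    rfl
  · refine (key _ (hf.1.norm.pow 2)).symm.trans (integral_congr_ae ?_)
    filter_upwards [hF.coeFn_toLp] with x hx
    rw [hx]; rfl

lemma waveCoeff_shift (θ : Pt d) (k : Fin d → ℤ) (f : Pt d → ℂ) :
    waveCoeff (shift θ k) f = waveCoeff (shift 0 k) fun y => wave (-θ) y * f y := by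
  unfold waveCoeff
  congr 1
  funext y
  rw [wave_shift, map_mul, conj_wave]
  ring

/-- **Parseval's identity** for the quasi-periodic plane waves. -/
lemma hasSum_sq_waveCoeff (θ : Pt d) {f : Pt d → ℂ} (hf : MemLp f 2 (cellMeasure d)) :
    HasSum (fun k => ‖waveCoeff (shift θ k) f‖ ^ 2) (∫ y in cell d, ‖f y‖ ^ 2) := by
  -- Multiplication by the unimodular `wave (-θ)` reduces the quasi-periodic system to the periodic
  -- one.
  have hg : MemLp (fun y => wave (-θ) y * f y) 2 (cellMeasure d) :=
    hf.of_le ((continuous_wave _).aestronglyMeasurable.mul hf.1) (.of_forall fun y => by simp)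
  have := hasSum_sq_waveCoeff_zero hg
  simpa only [← waveCoeff_shift, norm_mul, norm_wave, one_mul] using this

end Parseval

/-! ### Integration by parts -/

section Parts

variable {d : ℕ}

/-- Divergence theorem for the field whose only nonzero component is `ψ`, in position `j`: the
contributions of the two opposite faces cancel by periodicity. -/
lemma integral_fderiv_eq_zero_of_periodic {ψ : Pt d → ℂ} (hψ : ContDiff ℝ 1 ψ)
    (hper : ∀ k x, ψ (x + latticePt k) = ψ x) (j : Fin d) :
    ∫ y in cell d, fderiv ℝ ψ y (EuclideanSpace.single j 1) = 0 := by
  obtain _ | m := d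
  · exact j.elim0
  rw [setIntegral_cell]
  let L : (Fin (m + 1) → ℝ) →L[ℝ] Pt (m + 1) :=
    ((EuclideanSpace.equiv (Fin (m + 1)) ℝ).symm : (Fin (m + 1) → ℝ) →L[ℝ] Pt (m + 1))
  let f : Fin (m + 1) → (Fin (m + 1) → ℝ) → ℂ := fun i x => if i = j then ψ (L x) else 0
  let f' : Fin (m + 1) → (Fin (m + 1) → ℝ) → (Fin (m + 1) → ℝ) →L[ℝ] ℂ := fun i x =>
    if i = j then (fderiv ℝ ψ (L x)).comp L else 0
  have hLs : L (Pi.single j 1) = EuclideanSpace.single j 1 := by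
    ext i; simp [L, EuclideanSpace.equiv]
  have hsum : ∀ x, ∑ i, f' i x (Pi.single i 1) =
      fderiv ℝ ψ (WithLp.toLp 2 x) (EuclideanSpace.single j 1) := by
    intro x
    rw [Finset.sum_eq_single j]
    · simp only [f', if_true, ContinuousLinearMap.comp_apply, hLs]; rfl
    · intro b _ hb; simp [f', hb]
    · simp
  have hcont : Continuous fun x : Fin (m + 1) → ℝ =>
      fderiv ℝ ψ (L x) (EuclideanSpace.single j 1) :=
    ((hψ.continuous_fderiv one_ne_zero).comp L.continuous).clm_apply continuous_const
  have h := integral_divergence_of_hasFDerivAt_off_countable' (0 : Fin (m + 1) → ℝ) 1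
    (fun _ => zero_le_one) f f' ∅ Set.countable_empty
    (fun i => by
      by_cases hi : i = j
      · simp only [f, hi, if_true]
        exact (hψ.continuous.comp L.continuous).continuousOn
      · simp only [f, hi, if_false]; exact continuousOn_const)
    (fun x _ i => by
      by_cases hi : i = j
      · simp only [f, f', hi, if_true]
        exact ((hψ.differentiable one_ne_zero).differentiableAt.hasFDerivAt).comp x L.hasFDerivAt
      · simp only [f, f', hi, if_false]; exact hasFDerivAt_const _ _)
    (by
      simp only [hsum]
      exact hcont.continuousOn.integrableOn_compact isCompact_Icc)
  simp only [hsum] at h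
  rw [h]
  refine Finset.sum_eq_zero fun i _ => ?_
  obtain rfl | hi := eq_or_ne i j
  · rw [sub_eq_zero]
    congr 1
    funext x
    simp only [f, if_true]
    rw [← hper (Pi.single i 1) (L (i.insertNth ((0 : Fin (m + 1) → ℝ) i) x))]
    congr 1
    ext l
    refine Fin.succAboveCases i ?_ (fun l => ?_) l
    · simp [L, EuclideanSpace.equiv, latticePt]
    · simp [L, EuclideanSpace.equiv, latticePt, Pi.single_apply]
  · simp [f, hi]

/-- The Fourier coefficients of a partial derivative of a quasi-periodic function. -/
lemma waveCoeff_fderiv {θ : Pt d} {g : Pt d → ℂ} (hg : ContDiff ℝ 1 g)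
    (hper : ∀ k x, g (x + latticePt k) = wave θ (latticePt k) * g x) (k : Fin d → ℤ) (j : Fin d) :
    waveCoeff (shift θ k) (fun y => fderiv ℝ g y (EuclideanSpace.single j 1)) =
      I * shift θ k j * waveCoeff (shift θ k) g := by
  set ξ := shift θ k with hξ
  have hw : ContDiff ℝ 1 (wave (-ξ)) := (contDiff_wave (-ξ)).of_le (by norm_cast)
  -- The product with the conjugate wave is periodic, because `ξ` and `θ` give the same phase at
  -- lattice points.
  have h := integral_fderiv_eq_zero_of_periodic (hw.mul hg) (fun m x => by
    rw [hper, wave_add_right, ← conj_wave ξ (latticePt m), hξ, wave_shift_latticePt, conj_wave,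
      ← hξ]
    linear_combination (wave (-ξ) x * g x) * wave_mul_wave_neg θ (latticePt m)) j
  have h' : ∀ y, fderiv ℝ (fun y => wave (-ξ) y * g y) y (EuclideanSpace.single j 1) =
      wave (-ξ) y * fderiv ℝ g y (EuclideanSpace.single j 1) -
        I * ξ j * (wave (-ξ) y * g y) := by
    intro y
    rw [fderiv_fun_mul (hw.differentiable one_ne_zero).differentiableAt
      (hg.differentiable one_ne_zero).differentiableAt]
    simp only [add_apply, smul_apply, fderiv_wave_single,
      smul_eq_mul, PiLp.neg_apply]
    push_cast
    ring
  simp only [h'] at h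
  have hc1 : Continuous fun y => wave (-ξ) y * fderiv ℝ g y (EuclideanSpace.single j 1) :=
    hw.continuous.mul ((hg.continuous_fderiv one_ne_zero).clm_apply continuous_const)
  have hc2 : Continuous fun y => I * ξ j * (wave (-ξ) y * g y) :=
    continuous_const.mul (hw.continuous.mul hg.continuous)
  rw [integral_sub ((memLp_cell_of_continuous hc1 1).integrable le_rfl)
    ((memLp_cell_of_continuous hc2 1).integrable le_rfl), sub_eq_zero, integral_const_mul] at h
  simpa only [waveCoeff, conj_wave] using h

end Parts

end FibreHom

namespace FibreHom

/-! ### Plane waves as elements of `L²(Y)` -/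

section PlaneWave

variable {d : ℕ} {E : Type*} [NormedAddCommGroup E]

lemma memLp_wave_smul [NormedSpace ℂ E] (ξ : Pt d) (v : E) (p : ENNReal) :
    MemLp (fun y => wave ξ y • v) p (cellMeasure d) :=
  memLp_cell_of_continuous ((continuous_wave ξ).smul continuous_const) p

/-- The plane wave `y ↦ exp(i ξ · y) v` in `L²(Y)`. -/
noncomputable def planeWave [NormedSpace ℂ E] (ξ : Pt d) (v : E) : Lp E 2 (cellMeasure d) :=
  (memLp_wave_smul ξ v 2).toLp

lemma coeFn_planeWave [NormedSpace ℂ E] (ξ : Pt d) (v : E) :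
    (planeWave ξ v : Pt d → E) =ᵐ[cellMeasure d] fun y => wave ξ y • v :=
  (memLp_wave_smul ξ v 2).coeFn_toLp

lemma inner_planeWave [InnerProductSpace ℂ E] (ξ : Pt d) (v : E) (u : Lp E 2 (cellMeasure d)) :
    inner ℂ (planeWave ξ v) u = waveCoeff ξ fun y => inner ℂ v (u y) := by
  rw [L2.inner_def]
  refine integral_congr_ae ?_
  filter_upwards [coeFn_planeWave ξ v] with y hy
  rw [hy, inner_smul_left]

variable {ι : Type*} [Fintype ι] [DecidableEq ι]

lemma inner_planeWave_single (ξ : Pt d) (i : ι)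
    (u : Lp (EuclideanSpace ℂ ι) 2 (cellMeasure d)) :
    inner ℂ (planeWave ξ (EuclideanSpace.single i (1 : ℂ))) u = waveCoeff ξ fun y => u y i := by
  simp [inner_planeWave, EuclideanSpace.inner_single_left]

omit [DecidableEq ι] in
lemma memLp_coord {f : Pt d → EuclideanSpace ℂ ι} {p : ENNReal}
    (hf : MemLp f p (cellMeasure d)) (i : ι) : MemLp (fun y => f y i) p (cellMeasure d) :=
  (EuclideanSpace.proj i : EuclideanSpace ℂ ι →L[ℂ] ℂ).comp_memLp' hf

omit [DecidableEq ι] in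
lemma norm_sq_eq_integral (u : Lp (EuclideanSpace ℂ ι) 2 (cellMeasure d)) :
    ‖u‖ ^ 2 = ∑ i, ∫ y in cell d, ‖u y i‖ ^ 2 := by
  classical
  rw [← integral_finsetSum _ fun i _ => (memLp_coord (Lp.memLp u) i).integrable_norm_pow two_ne_zero,
    @norm_sq_eq_re_inner ℂ, L2.inner_def]
  have : ∀ y, inner ℂ (u y) (u y) = ((∑ i, ‖u y i‖ ^ 2 : ℝ) : ℂ) := fun y => by
    rw [inner_self_eq_norm_sq_to_K, ← EuclideanSpace.norm_sq_eq]
    norm_cast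
  simp_rw [this]
  rw [integral_complex_ofReal]
  simp

/-- Parseval's identity for vector-valued functions. -/
lemma hasSum_norm_sq_inner_planeWave (θ : Pt d)
    (u : Lp (EuclideanSpace ℂ ι) 2 (cellMeasure d)) :
    HasSum (fun k => ∑ i,
      ‖inner ℂ (planeWave (shift θ k) (EuclideanSpace.single i (1 : ℂ))) u‖ ^ 2) (‖u‖ ^ 2) := by
  rw [norm_sq_eq_integral]
  simp only [inner_planeWave_single]
  exact hasSum_sum fun i _ => hasSum_sq_waveCoeff θ (memLp_coord (Lp.memLp u) i)

end PlaneWave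

/-! ### The graph of the quasi-periodic gradient -/

section Gradient

variable {n d : ℕ}

lemma gradient_apply {φ : Pt d → Vec n} {y : Pt d} (h : DifferentiableAt ℝ φ y)
    (p : Fin n × Fin d) :
    gradient φ y p = fderiv ℝ (fun y => φ y p.1) y (EuclideanSpace.single p.2 1) := by
  have := ((EuclideanSpace.proj p.1 : Vec n →L[ℂ] ℂ).restrictScalars ℝ).hasFDerivAt.comp y
    h.hasFDerivAt
  have h2 : HasFDerivAt (fun y => φ y p.1)
    (((EuclideanSpace.proj p.1 : Vec n →L[ℂ] ℂ).restrictScalars ℝ).comp (fderiv ℝ φ y)) y := this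
  rw [h2.fderiv]
  rfl

/-- Pairs `(φ, grad φ)` of smooth quasi-periodic functions, as a subspace of `L² × L²`. -/
noncomputable def smoothGraph (θ : Pt d) : Submodule ℂ (L2Vec n d × L2Mat n d) where
  carrier := {p | ∃ φ : Pt d → Vec n, SmoothQuasiPeriodic θ φ ∧
    (p.1 : Pt d → Vec n) =ᵐ[cellMeasure d] φ ∧
    (p.2 : Pt d → Mat n d) =ᵐ[cellMeasure d] gradient φ}
  zero_mem' := by
    refine ⟨0, ⟨contDiff_const, by simp⟩, Lp.coeFn_zero _ _ _,
      (Lp.coeFn_zero _ _ _).trans (.of_forall fun y => ?_)⟩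
    ext p
    simp [gradient]
  add_mem' := by
    rintro p q ⟨φ, hφ, h1, h2⟩ ⟨ψ, hψ, h3, h4⟩
    refine ⟨φ + ψ, ⟨hφ.smooth.add hψ.smooth, fun k x => ?_⟩, ?_, ?_⟩
    · simp [hφ.quasiPeriodic, hψ.quasiPeriodic]
    · exact (Lp.coeFn_add _ _).trans (h1.add h3)
    · refine (Lp.coeFn_add _ _).trans ((h2.add h4).trans (.of_forall fun y => ?_))
      have := fderiv_add (hφ.smooth.differentiable (by simp) y)
        (hψ.smooth.differentiable (by simp) y)
      ext p
      simp [gradient, this]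
  smul_mem' := by
    rintro c p ⟨φ, hφ, h1, h2⟩
    refine ⟨c • φ, ⟨contDiff_const.smul hφ.smooth, fun k x => ?_⟩, ?_, ?_⟩
    · simp [hφ.quasiPeriodic, smul_comm c]
    · exact (Lp.coeFn_smul _ _).trans (h1.const_smul c)
    · refine (Lp.coeFn_smul _ _).trans ((h2.const_smul c).trans (.of_forall fun y => ?_))
      have := fderiv_const_smul (hφ.smooth.differentiable (by simp) y) c
      ext p
      simp [gradient, this]

/-- The relation between the Fourier coefficients of `u` and `grad_θ u`. -/
lemma inner_planeWave_of_mem_gradGraph {θ : Pt d} {p : L2Vec n d × L2Mat n d}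
    (hp : p ∈ gradGraph θ) (k : Fin d → ℤ) (i : Fin n) (j : Fin d) :
    inner ℂ (planeWave (shift θ k) (matUnit i j)) p.2 =
      I * shift θ k j *
        inner ℂ (planeWave (shift θ k) (EuclideanSpace.single i (1 : ℂ))) p.1 := by
  have hcl : IsClosed {p : L2Vec n d × L2Mat n d |
      inner ℂ (planeWave (shift θ k) (matUnit i j)) p.2 = I * shift θ k j *
        inner ℂ (planeWave (shift θ k) (EuclideanSpace.single i (1 : ℂ))) p.1} :=
    isClosed_eq (continuous_const.inner continuous_snd)
      (continuous_const.mul (continuous_const.inner continuous_fst))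
  refine closure_minimal ?_ hcl hp
  rintro q ⟨φ, hφ, h1, h2⟩
  have hd := hφ.smooth.differentiable (by simp)
  have hc : ContDiff ℝ ∞ fun y => φ y i :=
    ((EuclideanSpace.proj i : Vec n →L[ℂ] ℂ).restrictScalars ℝ).contDiff.comp hφ.smooth
  have key := waveCoeff_fderiv (θ := θ) (g := fun y => φ y i) (hc.of_le (by norm_cast))
    (fun m x => by simp [hφ.quasiPeriodic]) k j
  rw [Set.mem_ofPred_eq, matUnit, inner_planeWave_single, inner_planeWave_single]
  have e1 : waveCoeff (shift θ k) (fun y => q.1 y i) = waveCoeff (shift θ k) fun y => φ y i := by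
    refine integral_congr_ae ?_
    filter_upwards [h1] with y hy
    rw [hy]
  have e2 : waveCoeff (shift θ k) (fun y => q.2 y (i, j)) = waveCoeff (shift θ k) fun y =>
      fderiv ℝ (fun y => φ y i) y (EuclideanSpace.single j 1) := by
    refine integral_congr_ae ?_
    filter_upwards [h2] with y hy
    rw [hy, gradient_apply (hd y)]
  rw [e1, e2, key]

lemma orthWave_iff {θ : Pt d} {u : L2Vec n d} :
    OrthWave θ u ↔ ∀ i, inner ℂ (planeWave θ (EuclideanSpace.single i (1 : ℂ))) u = 0 := by
  simp only [inner_planeWave_single]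
  rfl

/-- The gradient of `y ↦ exp(i ξ · y) v`, up to the factor `exp(i ξ · y)`. -/
noncomputable def waveGradient (ξ : Pt d) (v : Vec n) : Mat n d :=
  WithLp.toLp 2 fun p => I * ξ p.2 * v p.1

lemma planeWave_mem_gradGraph (θ : Pt d) (k : Fin d → ℤ) (v : Vec n) :
    (planeWave (shift θ k) v, planeWave (shift θ k) (waveGradient (shift θ k) v)) ∈
      gradGraph θ := by
  refine subset_closure ⟨fun y => wave (shift θ k) y • v,
    ⟨(contDiff_wave _).smul contDiff_const, fun m x => ?_⟩, coeFn_planeWave _ _,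
    (coeFn_planeWave _ _).trans (.of_forall fun y => ?_)⟩
  · rw [wave_add_right, wave_shift_latticePt, mul_comm, mul_smul]
  · have hw : DifferentiableAt ℝ (wave (shift θ k)) y :=
      (contDiff_wave (shift θ k)).differentiable (by simp) y
    ext p
    rw [gradient_apply (hw.smul_const v)]
    simp only [PiLp.smul_apply, smul_eq_mul]
    rw [fderiv_mul_const hw]
    simp [waveGradient, fderiv_wave_single]
    ring

/-- The wave is an eigenfunction of `∂_j`. Integration by parts produces the eigenvalue of the other
wave, and the two differ by a nonzero multiple of `2πi` when `k j ≠ m j`. -/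
lemma waveCoeff_const_of_ne {k m : Fin d → ℤ} (θ : Pt d) (hkm : k ≠ m) :
    waveCoeff (shift θ k) (wave (shift θ m)) = 0 := by
  obtain ⟨j, hj⟩ := Function.ne_iff.1 hkm
  have h := waveCoeff_fderiv (θ := θ) (g := wave (shift θ m))
    ((contDiff_wave _).of_le (by norm_cast))
    (fun l x => by rw [wave_add_right, wave_shift_latticePt, mul_comm]) k j
  have h2 : waveCoeff (shift θ k) (fun y => fderiv ℝ (wave (shift θ m)) y
      (EuclideanSpace.single j 1)) =
      I * shift θ m j * waveCoeff (shift θ k) (wave (shift θ m)) := by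
    unfold waveCoeff
    rw [← integral_const_mul]
    congr 1
    funext y
    beta_reduce
    rw [fderiv_wave_single]
    ring
  rw [h2] at h
  have h3 : (I * ((2 * Real.pi * (k j - m j) : ℝ) : ℂ)) *
      waveCoeff (shift θ k) (wave (shift θ m)) = 0 := by
    simp only [shift_apply] at h
    push_cast at h ⊢
    linear_combination -h
  refine (mul_eq_zero.1 h3).resolve_left (mul_ne_zero I_ne_zero ?_)
  rw [Complex.ofReal_ne_zero]
  have : (k j - m j : ℝ) ≠ 0 := sub_ne_zero.2 (by exact_mod_cast hj)
  positivity

lemma inner_planeWave_planeWave_of_ne {E : Type*} [NormedAddCommGroup E] [InnerProductSpace ℂ E]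
    {k m : Fin d → ℤ} (θ : Pt d) (hkm : k ≠ m) (v w : E) :
    inner ℂ (planeWave (shift θ k) v) (planeWave (shift θ m) w) = 0 := by
  rw [inner_planeWave]
  have : waveCoeff (shift θ k) (fun y => inner ℂ v (planeWave (shift θ m) w y)) =
      waveCoeff (shift θ k) (wave (shift θ m)) * inner ℂ v w := by
    unfold waveCoeff
    rw [← integral_mul_const]
    refine integral_congr_ae ?_
    filter_upwards [coeFn_planeWave (shift θ m) w] with y hy
    rw [hy, inner_smul_right]
    ring
  rw [this, waveCoeff_const_of_ne θ hkm, zero_mul]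

lemma orthWave_planeWave {k : Fin d → ℤ} (θ : Pt d) (hk : k ≠ 0) (v : Vec n) :
    OrthWave θ (planeWave (shift θ k) v) := by
  rw [orthWave_iff]
  intro i
  simpa using inner_planeWave_planeWave_of_ne θ hk.symm (EuclideanSpace.single i (1 : ℂ)) v

/-- The term `2πk_j` has modulus at least `2π` and `|θ_j| ≤ π`. The choice of `Θ` as the cube of
side `2π` centred at the origin enters here. -/
lemma pi_le_abs_shift {θ : Pt d} (hθ : θ ∈ quasimomenta d) {k : Fin d → ℤ} {j : Fin d}
    (hk : k j ≠ 0) : Real.pi ≤ |shift θ k j| := by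
  have h := hθ j
  have hpi := Real.pi_pos
  rw [shift_apply]
  rcases lt_or_gt_of_ne hk with h0 | h0
  · have h1 : (k j : ℝ) ≤ -1 := by exact_mod_cast Int.le_sub_one_of_lt h0
    rw [abs_of_neg (by nlinarith [h.2])]
    nlinarith [h.2]
  · have h1 : (1 : ℝ) ≤ k j := by exact_mod_cast h0
    exact le_trans (by nlinarith [h.1]) (le_abs_self _)

/-- **Poincaré's inequality** on the orthogonal complement of `exp(i θ · y)`. -/
lemma pi_mul_norm_le {θ : Pt d} (hθ : θ ∈ quasimomenta d) {p : L2Vec n d × L2Mat n d}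
    (hp : p ∈ gradGraph θ) (ho : OrthWave θ p.1) : Real.pi * ‖p.1‖ ≤ ‖p.2‖ := by
  refine le_of_sq_le_sq ?_ (norm_nonneg _)
  rw [mul_pow]
  refine hasSum_le (fun k => ?_) ((hasSum_norm_sq_inner_planeWave θ p.1).mul_left _)
    (hasSum_norm_sq_inner_planeWave θ p.2)
  rw [Finset.mul_sum, Fintype.sum_prod_type]
  refine Finset.sum_le_sum fun i _ => ?_
  by_cases hk : k = 0
  · subst hk
    rw [shift_zero, orthWave_iff.1 ho i]
    simp only [norm_zero, ne_eq, OfNat.ofNat_ne_zero, not_false_eq_true, zero_pow, mul_zero]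
    positivity
  · obtain ⟨j, hj⟩ := Function.ne_iff.1 hk
    -- One direction `j` with `k_j ≠ 0` already supplies the factor `π²`.
    refine le_trans ?_ (Finset.single_le_sum (fun l _ => sq_nonneg _) (Finset.mem_univ j))
    have := inner_planeWave_of_mem_gradGraph hp k i j
    rw [matUnit] at this
    rw [this, norm_mul, mul_pow]
    gcongr
    rw [norm_mul, norm_I, one_mul, Complex.norm_real, Real.norm_eq_abs]
    exact pi_le_abs_shift hθ hj

/-- The graph of the restriction of `grad_θ` to the orthogonal complement of `exp(i θ · y)`. -/
noncomputable def orthGraph (θ : Pt d) : Submodule ℂ (L2Vec n d × L2Mat n d) :=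
  (smoothGraph θ).topologicalClosure ⊓
    ⨅ i : Fin n, LinearMap.ker (((innerSL ℂ (planeWave θ (EuclideanSpace.single i (1 : ℂ)))).comp
      (ContinuousLinearMap.fst ℂ (L2Vec n d) (L2Mat n d))).toLinearMap)

lemma mem_orthGraph {θ : Pt d} {p : L2Vec n d × L2Mat n d} :
    p ∈ orthGraph θ ↔ p ∈ gradGraph θ ∧ OrthWave θ p.1 := by
  rw [orthWave_iff, orthGraph, Submodule.mem_inf, Submodule.mem_iInf]
  rfl

lemma isClosed_orthGraph (θ : Pt d) :
    IsClosed (orthGraph (n := n) θ : Set (L2Vec n d × L2Mat n d)) := by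
  rw [orthGraph, Submodule.coe_inf, Submodule.coe_iInf]
  exact (Submodule.isClosed_topologicalClosure _).inter
    (isClosed_iInter fun i => ContinuousLinearMap.isClosed_ker _)

/-- The range of `grad_θ` on the orthogonal complement of `exp(i θ · y)`. -/
noncomputable def gradRange (θ : Pt d) : Submodule ℂ (L2Mat n d) :=
  (orthGraph θ).map (LinearMap.snd ℂ (L2Vec n d) (L2Mat n d))

/-- By Poincaré's inequality the projection `(u, grad u) ↦ grad u` is bounded below on the closed
graph, so its image is closed. -/
lemma isClosed_gradRange {θ : Pt d} (hθ : θ ∈ quasimomenta d) :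
    IsClosed (gradRange (n := n) θ : Set (L2Mat n d)) := by
  have : CompleteSpace (orthGraph (n := n) θ) :=
    (isClosed_orthGraph θ).completeSpace_coe
  let f : orthGraph (n := n) θ →L[ℂ] L2Mat n d :=
    (ContinuousLinearMap.snd ℂ (L2Vec n d) (L2Mat n d)).comp (orthGraph θ).subtypeL
  have hf : AntilipschitzWith 1 f := by
    refine f.antilipschitz_of_bound fun p => ?_
    obtain ⟨h1, h2⟩ := mem_orthGraph.1 p.2
    have h := pi_mul_norm_le hθ h1 h2
    rw [NNReal.coe_one, one_mul]
    -- The product carries the maximum norm, and `π ≥ 1` makes the constant `1` sufficient.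
    refine max_le ?_ le_rfl
    refine le_trans ?_ h
    change ‖p.1.1‖ ≤ _
    nlinarith [norm_nonneg p.1.1, Real.two_le_pi]
  convert hf.isClosed_range f.uniformContinuous
  ext q
  simp [gradRange, f]

end Gradient

/-! ### The Lax–Milgram lemma -/

/-- The compression of `T` to `W` is bounded below by coercivity, hence has closed range; a vector
`x` orthogonal to the range is orthogonal to its own image, so coercivity forces `x = 0`. -/
lemma exists_mem_forall_inner_eq_of_coercive {𝕜 E : Type*} [RCLike 𝕜] [NormedAddCommGroup E]
    [InnerProductSpace 𝕜 E] [CompleteSpace E] {W : Submodule 𝕜 E} (hW : IsClosed (W : Set E))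
    (T : E →L[𝕜] E) {ν : ℝ} (hν : 0 < ν)
    (hT : ∀ x, ν * ‖x‖ ^ 2 ≤ RCLike.re (inner 𝕜 x (T x))) (f : E) :
    ∃ w ∈ W, ∀ v ∈ W, inner 𝕜 v (T w) = inner 𝕜 v f := by
  have : CompleteSpace W := hW.completeSpace_coe
  let S : W →L[𝕜] W := W.orthogonalProjectionOnto.comp (T.comp W.subtypeL)
  have hS : ∀ v w : W, inner 𝕜 v (S w) = inner 𝕜 (v : E) (T w) := fun v w =>
    Submodule.inner_orthogonalProjectionOnto_eq_of_mem_left v (T w)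
  have hco : ∀ x : W, ν * ‖x‖ ^ 2 ≤ RCLike.re (inner 𝕜 x (S x)) := fun x => by
    rw [hS]; exact hT x
  have hanti : AntilipschitzWith ν.toNNReal⁻¹ S := by
    refine S.antilipschitz_of_bound fun x => ?_
    rw [NNReal.coe_inv, Real.coe_toNNReal ν hν.le, inv_mul_eq_div, le_div_iff₀ hν, mul_comm]
    rcases eq_or_ne x 0 with rfl | hx
    · simp
    · have h1 := (hco x).trans ((RCLike.re_le_norm _).trans (norm_inner_le_norm x (S x)))
      have h2 : 0 < ‖x‖ := norm_pos_iff.2 hx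
      nlinarith
  have hcl : IsClosed (S.range : Set W) := by
    rw [show (S.range : Set W) = Set.range S from LinearMap.coe_range _]
    exact hanti.isClosed_range S.uniformContinuous
  have : CompleteSpace S.range := hcl.completeSpace_coe
  have htop : S.range = ⊤ := by
    rw [← Submodule.orthogonal_eq_bot_iff, Submodule.eq_bot_iff]
    intro x hx
    have h0 : inner 𝕜 (S x) x = 0 := hx (S x) ⟨x, rfl⟩
    have h1 := hco x
    rw [← inner_conj_symm, h0, map_zero, map_zero] at h1
    have : ‖x‖ ^ 2 ≤ 0 := nonpos_of_mul_nonpos_right h1 hν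
    exact norm_eq_zero.1 (pow_eq_zero_iff two_ne_zero |>.1 (le_antisymm this (sq_nonneg _)))
  obtain ⟨w, hw⟩ : W.orthogonalProjectionOnto f ∈ S.range := htop ▸ Submodule.mem_top
  refine ⟨w, w.2, fun v hv => ?_⟩
  have h := hS ⟨v, hv⟩ w
  have hw' : S w = W.orthogonalProjectionOnto f := hw
  rw [hw', Submodule.inner_orthogonalProjectionOnto_eq_of_mem_left] at h
  exact h.symm

/-! ### The multiplication operator and the cell problem -/

section CellProblem

variable {n d : ℕ} {a : Pt d → Tensor n d}

/-- Multiplication by the coefficient `a` on `[L²(Y)]^{n × d}`. -/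
noncomputable def mulOp (ha : MemLp a ⊤ (cellMeasure d)) : L2Mat n d →L[ℂ] L2Mat n d :=
  (ContinuousLinearMap.id ℂ (Tensor n d)).holderL (cellMeasure d) ⊤ 2 2 ha.toLp

lemma coeFn_mulOp (ha : MemLp a ⊤ (cellMeasure d)) (G : L2Mat n d) :
    (mulOp ha G : Pt d → Mat n d) =ᵐ[cellMeasure d] fun y => a y (G y) := by
  have h := (ContinuousLinearMap.id ℂ (Tensor n d)).coeFn_holder (r := 2) ha.toLp G
  filter_upwards [h, ha.coeFn_toLp] with y h1 h2
  rw [mulOp, ContinuousLinearMap.holderL_apply_apply, h1, h2]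
  rfl

lemma coercive_mulOp (ha : MemLp a ⊤ (cellMeasure d)) {ν : ℝ}
    (h : ∀ᵐ x : Pt d, ∀ X : Mat n d, ν * ‖X‖ ^ 2 ≤ (inner ℂ X (a x X)).re) (G : L2Mat n d) :
    ν * ‖G‖ ^ 2 ≤ (inner ℂ G (mulOp ha G)).re := by
  have h1 : (inner ℂ G G).re = ‖G‖ ^ 2 := (@norm_sq_eq_re_inner ℂ _ _ _ _ G).symm
  rw [← h1, L2.inner_def, L2.inner_def]
  have e1 := integral_re (L2.integrable_inner (𝕜 := ℂ) G G)
  have e2 := integral_re (L2.integrable_inner (𝕜 := ℂ) G (mulOp ha G))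
  simp only [RCLike.re_to_complex] at e1 e2
  rw [← e1, ← e2, ← integral_const_mul]
  refine integral_mono_ae ((L2.integrable_inner (𝕜 := ℂ) G G).re.const_mul _)
    (L2.integrable_inner (𝕜 := ℂ) G (mulOp ha G)).re ?_
  filter_upwards [coeFn_mulOp ha G, ae_restrict_of_ae h] with y h1 h2
  have h3 := h2 (G y)
  simp only [h1, inner_self_eq_norm_sq_to_K]
  refine le_trans (le_of_eq ?_) h3
  norm_cast

lemma inner_mulOp_left (ha : MemLp a ⊤ (cellMeasure d))
    (hs : ∀ᵐ x : Pt d, IsSelfAdjoint (a x)) (F G : L2Mat n d) :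
    inner ℂ (mulOp ha F) G = inner ℂ F (mulOp ha G) := by
  rw [L2.inner_def, L2.inner_def]
  refine integral_congr_ae ?_
  filter_upwards [coeFn_mulOp ha F, coeFn_mulOp ha G, ae_restrict_of_ae hs] with y h1 h2 h3
  rw [h1, h2]
  exact (ContinuousLinearMap.isSelfAdjoint_iff_isSymmetric.1 h3) (F y) (G y)

lemma isCellSolution_iff (ha : MemLp a ⊤ (cellMeasure d)) {θ : Pt d} {r : Fin n} {s : Fin d}
    {p : L2Vec n d × L2Mat n d} :
    IsCellSolution a θ r s p ↔ p ∈ gradGraph θ ∧ OrthWave θ p.1 ∧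
      ∀ t ∈ gradGraph (n := n) θ, OrthWave θ t.1 →
        inner ℂ t.2 (mulOp ha (p.2 + planeWave θ (matUnit r s))) = 0 := by
  have key : ∀ G : L2Mat n d, inner ℂ G (mulOp ha (p.2 + planeWave θ (matUnit r s))) =
      ∫ y in cell d, inner ℂ (G y) (a y (p.2 y + wave θ y • matUnit r s)) := fun G => by
    rw [L2.inner_def]
    refine integral_congr_ae ?_
    filter_upwards [coeFn_mulOp ha (p.2 + planeWave θ (matUnit r s)),
      Lp.coeFn_add p.2 (planeWave θ (matUnit r s)),
      coeFn_planeWave θ (matUnit r s)] with y h1 h2 h3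
    rw [h1, h2, Pi.add_apply, h3]
  simp only [key]
  exact ⟨fun h => ⟨h.1, h.2, h.3⟩, fun h => ⟨h.1, h.2.1, h.2.2⟩⟩

lemma PeriodicCoercive.memLp_cell (h : PeriodicCoercive a) : MemLp a ⊤ (cellMeasure d) :=
  h.memLp.restrict _

/-- Lax–Milgram is applied to the gradient as the unknown, in `gradRange θ`. Coercivity controls
only gradients; Poincaré's inequality then makes the function itself unique. -/
theorem existsUnique_isCellSolution (h : PeriodicCoercive a) {θ : Pt d}
    (hθ : θ ∈ quasimomenta d) (r : Fin n) (s : Fin d) : ∃! p, IsCellSolution a θ r s p := by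
  obtain ⟨ν, hν, hco⟩ := h.coercive
  have hT := coercive_mulOp h.memLp_cell hco
  simp only [isCellSolution_iff h.memLp_cell]
  obtain ⟨w, ⟨p, hp, rfl⟩, hw⟩ := exists_mem_forall_inner_eq_of_coercive (isClosed_gradRange hθ)
    (mulOp h.memLp_cell) hν hT (-mulOp h.memLp_cell (planeWave θ (matUnit r s)))
  have hp' := mem_orthGraph.1 hp
  refine ⟨p, ⟨hp'.1, hp'.2, fun t ht hto => ?_⟩, ?_⟩
  · rw [map_add, inner_add_right]
    have := hw t.2 ⟨t, mem_orthGraph.2 ⟨ht, hto⟩, rfl⟩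
    rw [inner_neg_right] at this
    exact eq_neg_iff_add_eq_zero.1 this
  · rintro q ⟨hq1, hq2, hq3⟩
    have hqp : q - p ∈ orthGraph θ := sub_mem (mem_orthGraph.2 ⟨hq1, hq2⟩) hp
    obtain ⟨h1, h2⟩ := mem_orthGraph.1 hqp
    have e1 := hq3 _ h1 h2
    have e2 := hw (q - p).2 ⟨_, hqp, rfl⟩
    have e3 : inner ℂ (q - p).2 (mulOp h.memLp_cell (q - p).2) = 0 := by
      rw [map_add, inner_add_right] at e1
      rw [inner_neg_right] at e2
      conv_lhs => rw [Prod.snd_sub, map_sub, inner_sub_right, ← Prod.snd_sub]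
      simp only [LinearMap.snd_apply] at e2
      rw [e2]
      linear_combination e1
    have e4 := hT (q - p).2
    rw [e3, Complex.zero_re] at e4
    have e5 : ‖(q - p).2‖ = 0 := by
      have := nonpos_of_mul_nonpos_right e4 hν
      exact pow_eq_zero_iff two_ne_zero |>.1 (le_antisymm this (sq_nonneg _))
    have e6 := pi_mul_norm_le hθ h1 h2
    have e7 : ‖(q - p).1‖ = 0 := by
      nlinarith [Real.two_le_pi, norm_nonneg (q - p).1]
    exact sub_eq_zero.1 (Prod.ext (norm_eq_zero.1 e7) (norm_eq_zero.1 e5))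

end CellProblem

end FibreHom

namespace FibreHom

/-! ### Linear combinations of plane waves -/

section PlaneWaveLinear

variable {n d : ℕ}

lemma planeWave_add {E : Type*} [NormedAddCommGroup E] [NormedSpace ℂ E] (ξ : Pt d) (v w : E) :
    planeWave ξ (v + w) = planeWave ξ v + planeWave ξ w := by
  rw [planeWave, planeWave, planeWave, ← MemLp.toLp_add]
  exact MemLp.toLp_congr _ _ (.of_forall fun y => smul_add _ _ _)

lemma planeWave_smul {E : Type*} [NormedAddCommGroup E] [NormedSpace ℂ E] (ξ : Pt d) (c : ℂ)
    (v : E) : planeWave ξ (c • v) = c • planeWave ξ v := by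
  rw [planeWave, planeWave, ← MemLp.toLp_const_smul]
  exact MemLp.toLp_congr _ _ (.of_forall fun y => smul_comm _ _ _)

/-- `planeWave` as a linear map of the amplitude. -/
noncomputable def planeWaveₗ {E : Type*} [NormedAddCommGroup E] [NormedSpace ℂ E] (ξ : Pt d) :
    E →ₗ[ℂ] Lp E 2 (cellMeasure d) where
  toFun := planeWave ξ
  map_add' := planeWave_add ξ
  map_smul' := planeWave_smul ξ

lemma planeWave_eq_sum {ι : Type*} [Fintype ι] [DecidableEq ι] (ξ : Pt d)
    (X : EuclideanSpace ℂ ι) :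
    planeWave ξ X = ∑ p, X p • planeWave ξ (EuclideanSpace.single p (1 : ℂ)) := by
  have h : X = ∑ p, X p • EuclideanSpace.single p (1 : ℂ) := by
    ext q
    simp [Pi.single_apply]
  change planeWaveₗ ξ X = ∑ p, X p • planeWaveₗ ξ (EuclideanSpace.single p (1 : ℂ))
  conv_lhs => rw [h, map_sum]
  simp only [map_smul]

lemma inner_planeWave_mat_of_mem_gradGraph {θ : Pt d} {p : L2Vec n d × L2Mat n d}
    (hp : p ∈ gradGraph θ) (k : Fin d → ℤ) (X : Mat n d) :
    inner ℂ (planeWave (shift θ k) X) p.2 =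
      ∑ q : Fin n × Fin d, starRingEnd ℂ (X q) * (I * shift θ k q.2 *
        inner ℂ (planeWave (shift θ k) (EuclideanSpace.single q.1 (1 : ℂ))) p.1) := by
  rw [planeWave_eq_sum, sum_inner]
  refine Finset.sum_congr rfl fun q _ => ?_
  rw [inner_smul_left, ← inner_planeWave_of_mem_gradGraph hp k q.1 q.2]
  rfl

/-- A function all of whose nonzero Fourier coefficients vanish is constant. -/
lemma exists_eq_planeWave_zero {ι : Type*} [Fintype ι] [DecidableEq ι]
    (u : Lp (EuclideanSpace ℂ ι) 2 (cellMeasure d))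
    (h : ∀ k : Fin d → ℤ, k ≠ 0 → ∀ i,
      inner ℂ (planeWave (shift 0 k) (EuclideanSpace.single i (1 : ℂ))) u = 0) :
    ∃ C : EuclideanSpace ℂ ι, u = planeWave 0 C := by
  let C : EuclideanSpace ℂ ι :=
    WithLp.toLp 2 fun i => inner ℂ (planeWave 0 (EuclideanSpace.single i (1 : ℂ))) u
  refine ⟨C, sub_eq_zero.1 (norm_eq_zero.1 ((pow_eq_zero_iff two_ne_zero).1 ?_))⟩
  have hs := hasSum_norm_sq_inner_planeWave 0 (u - planeWave 0 C)
  refine hs.unique ?_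
  convert hasSum_zero using 2 with k
  refine Finset.sum_eq_zero fun i _ => ?_
  rw [inner_sub_right]
  by_cases hk : k = 0
  · subst hk
    have : inner ℂ (planeWave (0 : Pt d) (EuclideanSpace.single i (1 : ℂ))) (planeWave 0 C) =
        C i := by
      rw [inner_planeWave]
      have h1 : waveCoeff (0 : Pt d) (fun y => inner ℂ (EuclideanSpace.single i (1 : ℂ))
          (planeWave 0 C y)) = ∫ y in cell d, C i := by
        refine integral_congr_ae ?_
        filter_upwards [coeFn_planeWave (0 : Pt d) C] with y hy
        rw [hy]
        simp [EuclideanSpace.inner_single_left]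
      rw [h1]
      simp
    rw [shift_zero, this]
    simp [C]
  · have h2 := inner_planeWave_planeWave_of_ne (0 : Pt d) hk (EuclideanSpace.single i (1 : ℂ)) C
    rw [shift_zero] at h2
    rw [h k hk i, h2]
    simp

end PlaneWaveLinear

/-! ### The fibre-homogenised tensor -/

section Homogenised

variable {n d : ℕ} {a : Pt d → Tensor n d}

lemma zero_mem_gradGraph (θ : Pt d) : (0 : L2Vec n d × L2Mat n d) ∈ gradGraph θ :=
  (smoothGraph (n := n) θ).topologicalClosure.zero_mem

/-- The corrector vanishes exactly when the uncorrected flux is orthogonal to all admissible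
gradients. Both directions of the equivalence pass through this criterion. -/
lemma isCellSolution_zero_iff (ha : MemLp a ⊤ (cellMeasure d)) {θ : Pt d} {r : Fin n}
    {s : Fin d} :
    IsCellSolution a θ r s 0 ↔ ∀ t ∈ gradGraph (n := n) θ, OrthWave θ t.1 →
        inner ℂ t.2 (mulOp ha (planeWave θ (matUnit r s))) = 0 := by
  rw [isCellSolution_iff ha, Prod.snd_zero, zero_add]
  refine ⟨fun h => h.2.2, fun h => ⟨zero_mem_gradGraph θ, ?_, h⟩⟩
  rw [orthWave_iff]
  exact fun i => inner_zero_right _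

lemma cellSolution_eq (h : PeriodicCoercive a) {θ : Pt d} (hθ : θ ∈ quasimomenta d) {r : Fin n}
    {s : Fin d} {p : L2Vec n d × L2Mat n d} (hp : IsCellSolution a θ r s p) :
    cellSolution a θ r s = p :=
  (existsUnique_isCellSolution h hθ r s).unique (Classical.epsilon_spec ⟨p, hp⟩) hp

lemma sum_component_mul (A : Tensor n d) (i : Fin n) (j : Fin d) (X : Mat n d) :
    ∑ k, ∑ l, component A i j k l * X (k, l) = inner ℂ (matUnit i j) (A X) := by
  have hX : X = ∑ p : Fin n × Fin d, X p • matUnit p.1 p.2 := by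
    ext q
    simp [matUnit, Pi.single_apply]
  conv_rhs => rw [hX, map_sum, inner_sum, Fintype.sum_prod_type]
  refine Finset.sum_congr rfl fun k _ => Finset.sum_congr rfl fun l _ => ?_
  rw [map_smul, inner_smul_right, component, mul_comm]

lemma memLp_component (ha : MemLp a ⊤ (cellMeasure d)) (i : Fin n) (j : Fin d) (k : Fin n)
    (l : Fin d) : MemLp (fun y => component (a y) i j k l) ⊤ (cellMeasure d) :=
  ((innerSL ℂ (matUnit i j : Mat n d)).comp
    (ContinuousLinearMap.apply ℂ (Mat n d) (matUnit k l))).comp_memLp' ha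

/-- The sum of integrals becomes a sesquilinear form, to which self-adjointness and the cell problem
apply directly. -/
lemma aHom_eq_inner (h : PeriodicCoercive a) {θ : Pt d} (hθ : θ ∈ quasimomenta d) {r : Fin n}
    {s : Fin d} {p : L2Vec n d × L2Mat n d} (hp : IsCellSolution a θ r s p) (i : Fin n)
    (j : Fin d) :
    aHom a θ i j r s = inner ℂ (planeWave θ (matUnit i j))
      (mulOp h.memLp_cell (p.2 + planeWave θ (matUnit r s))) := by
  have ha := h.memLp_cell
  set Z := p.2 + planeWave θ (matUnit r s) with hZ
  have hZy : ∀ᵐ y ∂cellMeasure d, ∀ k l, Z y (k, l) = p.2 y (k, l) +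
      wave θ y * ((if k = r then 1 else 0) * (if l = s then 1 else 0)) := by
    filter_upwards [Lp.coeFn_add p.2 (planeWave θ (matUnit r s)),
      coeFn_planeWave θ (matUnit r s : Mat n d)] with y h2 h3 k l
    rw [hZ, h2, Pi.add_apply, h3]
    by_cases hk : k = r <;> by_cases hl : l = s <;> simp [matUnit, hk, hl]
  have hint : ∀ k l, Integrable (fun y => component (a y) i j k l * Z y (k, l) * wave (-θ) y)
      (cellMeasure d) := fun k l => by
    have h1 : MemLp (fun y => component (a y) i j k l * Z y (k, l)) 2 (cellMeasure d) :=
      (memLp_coord (Lp.memLp Z) (k, l)).mul (memLp_component ha i j k l)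
    have h2 : MemLp (wave (-θ)) ⊤ (cellMeasure d) :=
      memLp_cell_of_continuous (continuous_wave _) _
    exact (h2.mul (r := 2) h1).integrable one_le_two
  rw [aHom, cellSolution_eq h hθ hp, inner_planeWave]
  have e : ∀ k l, ∫ y in cell d, component (a y) i j k l * (p.2 y (k, l) +
        wave θ y * ((if k = r then 1 else 0) * (if l = s then 1 else 0))) * wave (-θ) y =
      ∫ y in cell d, component (a y) i j k l * Z y (k, l) * wave (-θ) y := fun k l => by
    refine integral_congr_ae ?_
    filter_upwards [hZy] with y hy
    rw [hy]
  simp only [e]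
  simp_rw [← integral_finsetSum _ fun l _ => hint _ l]
  rw [← integral_finsetSum _ fun k _ => integrable_finsetSum _ fun l _ => hint k l]
  refine integral_congr_ae ?_
  filter_upwards [coeFn_mulOp ha Z] with y hy
  simp only [← Finset.sum_mul]
  rw [hy, sum_component_mul, conj_wave, mul_comm]

/-- The coefficients of `a` conjugated by a plane wave do not depend on the plane wave. -/
lemma inner_planeWave_mulOp_planeWave (ha : MemLp a ⊤ (cellMeasure d)) (θ : Pt d)
    (k : Fin d → ℤ) (V X : Mat n d) :
    inner ℂ (planeWave (shift θ k) V) (mulOp ha (planeWave θ X)) =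
      inner ℂ (planeWave (shift 0 k) V) (mulOp ha (planeWave 0 X)) := by
  have key : ∀ θ : Pt d, inner ℂ (planeWave (shift θ k) V) (mulOp ha (planeWave θ X)) =
      waveCoeff (shift 0 k) fun y => inner ℂ V (a y X) := fun θ => by
    rw [inner_planeWave]
    refine integral_congr_ae ?_
    filter_upwards [coeFn_mulOp ha (planeWave θ X), coeFn_planeWave θ X] with y h1 h2
    rw [h1, h2, map_smul, inner_smul_right, wave_shift, map_mul, conj_wave]
    linear_combination (starRingEnd ℂ (wave (shift 0 k) y) * inner ℂ V (a y X)) *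
      wave_mul_wave_neg θ y
  rw [key θ, key 0]

/-- Without a corrector the phases cancel and only the mean of `a` remains, which does not involve
`θ`. -/
lemma aHom_of_isCellSolution_zero (h : PeriodicCoercive a) {θ : Pt d}
    (hθ : θ ∈ quasimomenta d) {r : Fin n} {s : Fin d} (hp : IsCellSolution a θ r s 0)
    (i : Fin n) (j : Fin d) :
    aHom a θ i j r s = inner ℂ (planeWave 0 (matUnit i j))
      (mulOp h.memLp_cell (planeWave 0 (matUnit r s))) := by
  rw [aHom_eq_inner h hθ hp, Prod.snd_zero, zero_add]
  simpa using inner_planeWave_mulOp_planeWave h.memLp_cell θ 0 (matUnit i j) (matUnit r s)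

lemma zero_mem_quasimomenta : (0 : Pt d) ∈ quasimomenta d := fun _ => by
  simp [Real.pi_pos, Real.pi_pos.le]

lemma SelfAdjointDivFree.isCellSolution_zero (h : SelfAdjointDivFree a) (r : Fin n)
    (s : Fin d) : IsCellSolution a 0 r s 0 := by
  rw [isCellSolution_zero_iff h.periodicCoercive.memLp_cell]
  intro t ht _
  obtain ⟨q, hq, hqe⟩ := h.divFree (matUnit r s)
  have : mulOp h.periodicCoercive.memLp_cell (planeWave 0 (matUnit r s)) = q := by
    refine Lp.ext ?_
    filter_upwards [coeFn_mulOp h.periodicCoercive.memLp_cell (planeWave 0 (matUnit r s)), hqe,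
      coeFn_planeWave (0 : Pt d) (matUnit r s : Mat n d)] with y h1 h2 h3
    rw [h1, h2, h3, wave_zero_left, one_smul]
  rw [this, hq t ht, inner_zero_right, neg_zero]

/-- If the diagonal component `a^hom_{rsrs}` agrees with the classical one, then the corrector
vanishes. -/
lemma SelfAdjointDivFree.isCellSolution_zero_of_aHom_eq (h : SelfAdjointDivFree a) {θ : Pt d}
    (hθ : θ ∈ quasimomenta d) {r : Fin n} {s : Fin d}
    (he : aHom a θ r s r s = aHom a 0 r s r s) : IsCellSolution a θ r s 0 := by
  have hpc := h.periodicCoercive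
  obtain ⟨p, hp, -⟩ := existsUnique_isCellSolution hpc hθ r s
  have hp' := (isCellSolution_iff hpc.memLp_cell).1 hp
  set M := mulOp hpc.memLp_cell with hM
  set E : L2Mat n d := planeWave θ (matUnit r s) with hE
  rw [aHom_eq_inner hpc hθ hp, aHom_of_isCellSolution_zero hpc zero_mem_quasimomenta
    (h.isCellSolution_zero r s)] at he
  have h0 := inner_planeWave_mulOp_planeWave hpc.memLp_cell θ 0 (matUnit r s) (matUnit r s)
  rw [shift_zero, shift_zero] at h0
  -- The mean of `a_{rsrs}` cancels from both sides, leaving `⟨E, M p.2⟩ = 0`.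
  rw [← h0, ← hM, ← hE, map_add, inner_add_right, add_eq_right] at he
  -- The corrector is its own test function; self-adjointness turns the cross term into the
  -- conjugate of `⟨E, M p.2⟩`.
  have h1 := hp'.2.2 p hp'.1 hp'.2.1
  rw [map_add, inner_add_right, ← inner_mulOp_left hpc.memLp_cell h.selfAdjoint p.2 E, ← hM,
    ← inner_conj_symm (M p.2) E, he, map_zero, add_zero] at h1
  obtain ⟨ν, hν, hco⟩ := hpc.coercive
  have h2 := coercive_mulOp hpc.memLp_cell hco p.2
  rw [← hM, h1, Complex.zero_re] at h2
  have h3 : ‖p.2‖ = 0 := pow_eq_zero_iff two_ne_zero |>.1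
    (le_antisymm (nonpos_of_mul_nonpos_right h2 hν) (sq_nonneg _))
  have h4 := pi_mul_norm_le hθ hp'.1 hp'.2.1
  have h5 : ‖p.1‖ = 0 := by nlinarith [Real.two_le_pi, norm_nonneg p.1]
  have : p = 0 := Prod.ext (norm_eq_zero.1 h5) (norm_eq_zero.1 h3)
  rwa [this] at hp

/-- The flux is a single wave of frequency `θ`. The coefficient of a gradient at that frequency is
`iθ` times that of the function, which vanishes by `OrthWave`. -/
lemma IsConstant.isCellSolution_zero (hc : IsConstant a) (ha : MemLp a ⊤ (cellMeasure d))
    (θ : Pt d) (r : Fin n) (s : Fin d) : IsCellSolution a θ r s 0 := by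
  obtain ⟨A, hA⟩ := hc
  rw [isCellSolution_zero_iff ha]
  intro t ht hto
  have : mulOp ha (planeWave θ (matUnit r s)) = planeWave θ (A (matUnit r s)) := by
    refine Lp.ext ?_
    filter_upwards [coeFn_mulOp ha (planeWave θ (matUnit r s)), ae_restrict_of_ae hA,
      coeFn_planeWave θ (matUnit r s : Mat n d),
      coeFn_planeWave θ (A (matUnit r s))] with y h1 h2 h3 h4
    rw [h1, h2, h3, h4, map_smul]
  have h2 := inner_planeWave_mat_of_mem_gradGraph ht 0 (A (matUnit r s))
  rw [shift_zero] at h2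
  rw [this, ← inner_conj_symm, h2, Finset.sum_eq_zero, map_zero]
  intro q _
  rw [orthWave_iff.1 hto q.1]
  simp

/-- The symbol of the gradient is affine in the quasimomentum, so two values of `θ` reach matrix
units, whereas `θ = 0` alone only sees the direction of `k`. -/
lemma waveGradient_shift_add (k : Fin d → ℤ) (m : Fin n) (j : Fin d) :
    waveGradient (shift (EuclideanSpace.single j 1) k) (EuclideanSpace.single m (1 : ℂ)) =
      waveGradient (shift 0 k) (EuclideanSpace.single m (1 : ℂ)) + I • matUnit m j := by
  ext ⟨i, l⟩
  simp only [waveGradient, shift_apply, matUnit, PiLp.add_apply, PiLp.smul_apply, smul_eq_mul,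
    PiLp.single_apply, PiLp.zero_apply, Prod.mk.injEq]
  by_cases hi : i = m <;> by_cases hl : l = j <;> simp [hi, hl, mul_add, add_comm]

lemma single_mem_quasimomenta (j : Fin d) :
    (EuclideanSpace.single j 1 : Pt d) ∈ quasimomenta d := fun l => by
  have := Real.two_le_pi
  rw [PiLp.single_apply]
  split_ifs <;> constructor <;> linarith

/-- If all correctors vanish, then `a` is constant on the cell. -/
lemma exists_ae_cell_eq (ha : MemLp a ⊤ (cellMeasure d))
    (h : ∀ θ ∈ quasimomenta d, ∀ (r : Fin n) (s : Fin d), IsCellSolution a θ r s 0) :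
    ∃ A : Tensor n d, ∀ᵐ y ∂cellMeasure d, a y = A := by
  have h1 : ∀ (r : Fin n) (s : Fin d) (k : Fin d → ℤ), k ≠ 0 → ∀ p : Fin n × Fin d,
      inner ℂ (planeWave (shift 0 k) (EuclideanSpace.single p (1 : ℂ)))
        (mulOp ha (planeWave 0 (matUnit r s))) = 0 := by
    rintro r s k hk ⟨m, j⟩
    have h2 : ∀ θ ∈ quasimomenta d, inner ℂ (planeWave (shift 0 k)
        (waveGradient (shift θ k) (EuclideanSpace.single m (1 : ℂ))))
        (mulOp ha (planeWave 0 (matUnit r s))) = 0 := fun θ hθ => by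
      rw [← inner_planeWave_mulOp_planeWave ha θ]
      exact (isCellSolution_zero_iff ha).1 (h θ hθ r s) _ (planeWave_mem_gradGraph θ k _)
        (orthWave_planeWave θ hk _)
    -- Only the quasimomenta `e_j` and `0` are compared; `e_j` lies in `Θ` since `1 < π`.
    have h3 := h2 _ (single_mem_quasimomenta j)
    rw [waveGradient_shift_add, planeWave_add, inner_add_left, h2 0 zero_mem_quasimomenta,
      zero_add, planeWave_smul, inner_smul_left] at h3
    exact (mul_eq_zero.1 h3).resolve_left (by simp)
  choose C hC using fun r s => exists_eq_planeWave_zero _ (h1 r s)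
  have h4 : ∀ᵐ y ∂cellMeasure d, ∀ r s, a y (matUnit r s) = C r s := by
    rw [ae_all_iff]; intro r
    rw [ae_all_iff]; intro s
    filter_upwards [coeFn_mulOp ha (planeWave 0 (matUnit r s)),
      coeFn_planeWave (0 : Pt d) (matUnit r s : Mat n d),
      coeFn_planeWave (0 : Pt d) (C r s)] with y e1 e2 e3
    rw [hC, e3, e2] at e1
    simpa using e1.symm
  obtain ⟨y₀, hy₀⟩ := h4.exists
  refine ⟨a y₀, ?_⟩
  filter_upwards [h4] with y hy
  refine ContinuousLinearMap.coe_injective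
    ((EuclideanSpace.basisFun (Fin n × Fin d) ℂ).toBasis.ext fun p => ?_)
  have := (hy p.1 p.2).trans (hy₀ p.1 p.2).symm
  simpa [matUnit] using this

/-- A periodic coefficient that is constant on the cell is constant. -/
lemma isConstant_of_ae_cell (hper : ∀ k : Fin d → ℤ, ∀ᵐ x : Pt d, a (x + latticePt k) = a x)
    {A : Tensor n d} (h : ∀ᵐ y ∂cellMeasure d, a y = A) : IsConstant a := by
  refine ⟨A, ?_⟩
  -- The half-open cube contains a lattice translate of every point, given by the floor of the
  -- coordinates, whereas the open cell misses a null set.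
  let Q : Set (Pt d) := (WithLp.ofLp : Pt d → Fin d → ℝ) ⁻¹' (Set.univ.pi fun _ => Set.Ico 0 1)
  have hQ : (Q : Set (Pt d)) =ᵐ[volume] cell d := by
    rw [cell_eq_preimage]
    refine (PiLp.volume_preserving_ofLp (Fin d)).quasiMeasurePreserving.preimage_ae_eq ?_
    exact (Measure.univ_pi_Ico_ae_eq_Icc (f := 0) (g := 1)).trans
      (Measure.univ_pi_Ioo_ae_eq_Icc (f := 0) (g := 1)).symm
  have h1 : ∀ᵐ y : Pt d, y ∈ Q → a y = A := by
    filter_upwards [(ae_restrict_iff' measurableSet_cell).1 h, hQ.mem_iff] with y h1 h2 h3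
    exact h1 (h2.1 h3)
  have h2 : ∀ᵐ x : Pt d, ∀ k : Fin d → ℤ,
      (x - latticePt k ∈ Q → a (x - latticePt k) = A) ∧
        a (x - latticePt k + latticePt k) = a (x - latticePt k) := by
    rw [ae_all_iff]
    intro k
    exact (measurePreserving_sub_right volume (latticePt k)).quasiMeasurePreserving.ae
      (h1.and (hper k))
  filter_upwards [h2] with x hx
  obtain ⟨h3, h4⟩ := hx fun j => ⌊x j⌋
  rw [sub_add_cancel] at h4
  rw [h4]
  refine h3 fun j _ => ?_
  exact ⟨Int.fract_nonneg (x j), Int.fract_lt_one (x j)⟩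

theorem SelfAdjointDivFree.aHom_eq_iff_isConstant (h : SelfAdjointDivFree a) :
    (∀ θ ∈ quasimomenta d, θ ≠ 0 → aHom a θ = aHom a 0) ↔ IsConstant a := by
  have hpc := h.periodicCoercive
  refine ⟨fun he => ?_, fun hc θ hθ _ => ?_⟩
  · obtain ⟨A, hA⟩ := exists_ae_cell_eq hpc.memLp_cell fun θ hθ r s => by
      -- The hypothesis excludes `θ = 0`, where divergence-freeness gives the zero corrector.
      by_cases h0 : θ = 0
      · rw [h0]; exact h.isCellSolution_zero r s
      · exact h.isCellSolution_zero_of_aHom_eq hθ (by rw [he θ hθ h0])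
    exact isConstant_of_ae_cell hpc.periodic hA
  · funext i j r s
    rw [aHom_of_isCellSolution_zero hpc hθ (hc.isCellSolution_zero hpc.memLp_cell θ r s),
      aHom_of_isCellSolution_zero hpc zero_mem_quasimomenta
        (hc.isCellSolution_zero hpc.memLp_cell 0 r s)]

end Homogenised

/-! ### A laminate -/

section Laminate

variable {n d : ℕ}

/-- The projection of `ℂ^{n × d}` onto the matrices supported in column `j`. -/
noncomputable def columnProj (n : ℕ) {d : ℕ} (j : Fin d) : Tensor n d :=
  LinearMap.toContinuousLinearMap
    { toFun := fun X => WithLp.toLp 2 fun p => if p.2 = j then X p else 0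
      map_add' := fun X Y => by ext p; by_cases h : p.2 = j <;> simp [h]
      map_smul' := fun c X => by ext p; by_cases h : p.2 = j <;> simp [h] }

lemma columnProj_apply (j : Fin d) (X : Mat n d) (p : Fin n × Fin d) :
    columnProj n j X p = if p.2 = j then X p else 0 := rfl

lemma isSelfAdjoint_columnProj (j : Fin d) : IsSelfAdjoint (columnProj n j) := by
  rw [ContinuousLinearMap.isSelfAdjoint_iff_isSymmetric]
  intro X Y
  simp only [PiLp.inner_apply, ContinuousLinearMap.coe_coe, columnProj_apply]
  refine Finset.sum_congr rfl fun p _ => ?_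
  split_ifs <;> simp

lemma inner_columnProj (j : Fin d) (X : Mat n d) :
    inner ℂ X (columnProj n j X) = ((‖columnProj n j X‖ ^ 2 : ℝ) : ℂ) := by
  rw [EuclideanSpace.norm_sq_eq, PiLp.inner_apply]
  push_cast
  refine Finset.sum_congr rfl fun p _ => ?_
  rw [columnProj_apply]
  split_ifs
  · simp
  · simp

lemma norm_columnProj_apply_le (j : Fin d) (X : Mat n d) : ‖columnProj n j X‖ ≤ ‖X‖ := by
  refine le_of_sq_le_sq ?_ (norm_nonneg _)
  rw [EuclideanSpace.norm_sq_eq, EuclideanSpace.norm_sq_eq]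
  refine Finset.sum_le_sum fun p _ => ?_
  rw [columnProj_apply]
  split_ifs
  · exact le_rfl
  · simp

/-- The laminate `y ↦ 1 + ½ cos(2π y_l) Π_j`, where `Π_j` projects onto column `j`. -/
noncomputable def laminate (n : ℕ) {d : ℕ} (l j : Fin d) (y : Pt d) : Tensor n d :=
  1 + ((Real.cos (2 * Real.pi * y l) / 2 : ℝ) : ℂ) • columnProj n j

lemma continuous_laminate (l j : Fin d) : Continuous (laminate n l j) := by
  unfold laminate
  fun_prop

lemma laminate_apply (l j : Fin d) (y : Pt d) (X : Mat n d) :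
    laminate n l j y X = X + ((Real.cos (2 * Real.pi * y l) / 2 : ℝ) : ℂ) • columnProj n j X := by
  simp [laminate]

lemma abs_cos_div_two_le (x : ℝ) : |Real.cos x / 2| ≤ 1 / 2 := by
  rw [abs_div, abs_two]
  linarith [Real.abs_cos_le_one x]

lemma periodicCoercive_laminate (l j : Fin d) : PeriodicCoercive (laminate n l j) where
  memLp := by
    refine memLp_top_of_bound (continuous_laminate l j).aestronglyMeasurable
      (‖(1 : Tensor n d)‖ + 1 / 2 * ‖columnProj n j‖) (.of_forall fun y => ?_)
    refine (norm_add_le _ _).trans ?_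
    rw [norm_smul, Complex.norm_real, Real.norm_eq_abs]
    gcongr
    exact abs_cos_div_two_le _
  periodic k := .of_forall fun x => by
    have : 2 * Real.pi * (x + latticePt k) l = 2 * Real.pi * x l + k l * (2 * Real.pi) := by
      simp [latticePt]; ring
    rw [laminate, this, Real.cos_add_int_mul_two_pi, laminate]
  coercive := by
    -- The factor `1 + ½ cos` on column `j` is at least `1/2`, and the other columns carry the
    -- factor `1`.
    refine ⟨1 / 2, by norm_num, .of_forall fun y X => ?_⟩
    rw [laminate_apply, inner_add_right, inner_smul_right, inner_columnProj, ← Complex.ofReal_mul,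
      Complex.add_re, Complex.ofReal_re]
    have h1 : (inner ℂ X X).re = ‖X‖ ^ 2 := (@norm_sq_eq_re_inner ℂ _ _ _ _ X).symm
    have h2 := (abs_le.1 (abs_cos_div_two_le (2 * Real.pi * y l))).1
    have h3 := norm_columnProj_apply_le j X
    rw [h1]
    nlinarith [norm_nonneg (columnProj n j X), sq_nonneg ‖columnProj n j X‖,
      mul_self_le_mul_self (norm_nonneg _) h3]

lemma wave_shift_zero_single (c : ℤ) (l : Fin d) (y : Pt d) :
    wave (shift 0 (Pi.single l c)) y = cexp (((2 * Real.pi * c * y l : ℝ) : ℂ) * I) := by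
  rw [wave, mul_comm, Finset.sum_eq_single l]
  · simp [shift_apply]
  · intro b _ hb
    simp [shift_apply, Pi.single_eq_of_ne hb]
  · simp

lemma cos_eq_wave (l : Fin d) (y : Pt d) :
    ((Real.cos (2 * Real.pi * y l) / 2 : ℝ) : ℂ) =
      (1 / 4) * (wave (shift 0 (Pi.single l 1)) y + wave (shift 0 (Pi.single l (-1))) y) := by
  rw [wave_shift_zero_single, wave_shift_zero_single]
  push_cast
  rw [Complex.cos]
  ring_nf

lemma isSelfAdjoint_laminate (l j : Fin d) (y : Pt d) : IsSelfAdjoint (laminate n l j y) := by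
  have h := ContinuousLinearMap.isSelfAdjoint_iff_isSymmetric.1 (isSelfAdjoint_columnProj (n := n) j)
  rw [ContinuousLinearMap.isSelfAdjoint_iff_isSymmetric]
  intro X Y
  have hXY : inner ℂ (columnProj n j X) Y = inner ℂ X (columnProj n j Y) := h X Y
  simp only [ContinuousLinearMap.coe_coe, laminate_apply, inner_add_left, inner_add_right,
    inner_smul_left, inner_smul_right, Complex.conj_ofReal, hXY]

/-- The `L²` function `y ↦ X + c (exp(i ξ · y) + exp(i η · y)) Z`. -/
noncomputable def twoWaves (ξ η : Pt d) (c : ℂ) (X Z : Mat n d) : L2Mat n d :=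
  planeWave 0 X + c • (planeWave ξ Z + planeWave η Z)

lemma coeFn_twoWaves (ξ η : Pt d) (c : ℂ) (X Z : Mat n d) :
    (twoWaves ξ η c X Z : Pt d → Mat n d) =ᵐ[cellMeasure d]
      fun y => X + (c * (wave ξ y + wave η y)) • Z := by
  unfold twoWaves
  filter_upwards [Lp.coeFn_add (planeWave 0 X) (c • (planeWave ξ Z + planeWave η Z)),
    Lp.coeFn_smul c (planeWave ξ Z + planeWave η Z),
    Lp.coeFn_add (planeWave ξ Z) (planeWave η Z), coeFn_planeWave 0 X, coeFn_planeWave ξ Z,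
    coeFn_planeWave η Z] with y h1 h2 h3 h4 h5 h6
  rw [h1, Pi.add_apply, h2, Pi.smul_apply, h3, Pi.add_apply, h4, h5, h6, wave_zero_left, one_smul,
    ← add_smul, smul_smul]

/-- The layers vary in direction `l` only, so at these frequencies the `j`-th component of the
symbol is zero, and column `j` is all that is paired with the gradient. -/
lemma inner_planeWave_columnProj {l j : Fin d} (hlj : l ≠ j) (c : ℤ) (X : Mat n d)
    {p : L2Vec n d × L2Mat n d} (hp : p ∈ gradGraph 0) :
    inner ℂ (planeWave (shift 0 (Pi.single l c)) (columnProj n j X)) p.2 = 0 := by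
  rw [inner_planeWave_mat_of_mem_gradGraph hp]
  refine Finset.sum_eq_zero fun q _ => ?_
  rw [columnProj_apply]
  split_ifs with hq
  · rw [hq, shift_apply, Pi.single_eq_of_ne hlj.symm]
    simp
  · simp

lemma inner_planeWave_zero (X : Mat n d) {p : L2Vec n d × L2Mat n d} (hp : p ∈ gradGraph 0) :
    inner ℂ (planeWave 0 X) p.2 = 0 := by
  have := inner_planeWave_mat_of_mem_gradGraph hp 0 X
  rw [shift_zero] at this
  rw [this]
  simp

lemma twoWaves_mem_kerDiv {l j : Fin d} (hlj : l ≠ j) (c : ℂ) (X Y : Mat n d) :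
    twoWaves (shift 0 (Pi.single l 1)) (shift 0 (Pi.single l (-1))) c X (columnProj n j Y) ∈
      kerDiv (n := n) (d := d) 0 := by
  intro p hp
  rw [inner_zero_right, neg_zero, ← inner_conj_symm, twoWaves, inner_add_left, inner_smul_left,
    inner_add_left, inner_planeWave_zero X hp, inner_planeWave_columnProj hlj 1 Y hp,
    inner_planeWave_columnProj hlj (-1) Y hp]
  simp

lemma selfAdjointDivFree_laminate {l j : Fin d} (hlj : l ≠ j) :
    SelfAdjointDivFree (laminate n l j) where
  periodicCoercive := periodicCoercive_laminate l j
  selfAdjoint := .of_forall (isSelfAdjoint_laminate l j)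
  divFree X := by
    refine ⟨_, twoWaves_mem_kerDiv hlj (1 / 4) X X, ?_⟩
    filter_upwards [coeFn_twoWaves (shift 0 (Pi.single l 1)) (shift 0 (Pi.single l (-1))) (1 / 4) X
      (columnProj n j X)] with y hy
    rw [hy, laminate_apply, cos_eq_wave]

lemma not_isConstant_laminate (hn : 1 ≤ n) (l j : Fin d) : ¬ IsConstant (laminate n l j) := by
  rintro ⟨A, hA⟩
  have h : laminate n l j = fun _ => A :=
    (continuous_laminate l j).ae_eq_iff_eq volume continuous_const |>.1 hA
  -- Half a period apart, the entry in column `j` takes the values `3/2` and `1/2`.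
  have h1 := (congrFun h 0).trans (congrFun h (EuclideanSpace.single l (1 / 2))).symm
  have h2 := congrArg (fun T : Tensor n d => T (matUnit ⟨0, hn⟩ j) (⟨0, hn⟩, j)) h1
  have h3 : 2 * Real.pi * (1 / 2) = Real.pi := by ring
  simp only [laminate_apply, PiLp.add_apply, PiLp.smul_apply, columnProj_apply, matUnit,
    PiLp.single_apply, PiLp.zero_apply, if_true, mul_zero, Real.cos_zero, h3, Real.cos_pi] at h2
  norm_num at h2

end Laminate

end FibreHom

theorem proposition4p5 (n d : ℕ) :
    (∀ a : FibreHom.Pt d → FibreHom.Tensor n d, FibreHom.SelfAdjointDivFree a →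
      -- the cell problems that define `a^hom(θ)` are uniquely solvable
      (∀ θ ∈ FibreHom.quasimomenta d, ∀ (r : Fin n) (s : Fin d),
        ∃! p, FibreHom.IsCellSolution a θ r s p) ∧
      ((∀ θ ∈ FibreHom.quasimomenta d, θ ≠ 0 → FibreHom.aHom a θ = FibreHom.aHom a 0) ↔
        FibreHom.IsConstant a)) ∧
    -- the fibre-homogenised tensor differs from the classical one in general
    (1 ≤ n → 2 ≤ d →
      ∃ a : FibreHom.Pt d → FibreHom.Tensor n d, FibreHom.SelfAdjointDivFree a ∧
        ∃ θ ∈ FibreHom.quasimomenta d, θ ≠ 0 ∧ FibreHom.aHom a θ ≠ FibreHom.aHom a 0) := by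
  refine ⟨fun a ha => ⟨fun θ hθ r s =>
    FibreHom.existsUnique_isCellSolution ha.periodicCoercive hθ r s,
    ha.aHom_eq_iff_isConstant⟩, fun hn hd => ?_⟩
  have hlj : (⟨0, by omega⟩ : Fin d) ≠ ⟨1, hd⟩ := by simp
  have h := FibreHom.selfAdjointDivFree_laminate (n := n) hlj
  refine ⟨_, h, ?_⟩
  -- No explicit `θ` is needed: equality for every `θ` would make the laminate constant.
  by_contra! hne
  exact FibreHom.not_isConstant_laminate hn _ _ (h.aHom_eq_iff_isConstant.1 hne)
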